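/- **Setting.** Let $G=(V,E)$ be a finite connected simple undirected graph with edge weights $|e|>0$ and a start vertex $s$. The length of a walk is the sum of the weights of its edges, counted with multiplicity. A searcher explores $G$ starting from $s$. At any time, some vertices are *explored*; the *known graph* consists of all edges of $G$ with at least one explored endpoint. A *boundary edge* $(u,v)$ is an edge of $G$ with $u$ explored and $v$ unexplored. For $\delta\in\mathbb{R}$, a boundary edge $e=(u,v)$ is *blocked* by a boundary edge $e'=(u',v')$ if $|e'|<|e|$ and the length of a shortest path from $u$ to $v'$ in the known graph is at most $(1+\delta)|e|$. The algorithm $\mathrm{Blocking}_\delta$ starts with the call $\mathrm{Blocking}_\delta(G,s)$. A call $\mathrm{Blocking}_\delta(G,y)$ marks $y$ as explored and then does the following: while there is a boundary edge $e=(u,v)$ that is not blocked by any boundary edge and such that $u=y$ or $e$ was at some earlier time blocked by some edge $(u',y)$, choose such an edge, walk a shortest path of the known graph from $y$ to $u$, traverse $e$, call $\mathrm{Blocking}_\delta(G,v)$, and, when that call has ended, walk a shortest path of the known graph from $v$ to $y$. (A vertex counts as explored exactly when it has been called.) Ties are broken arbitrarily. The algorithm is *$c$-competitive* on a class of graphs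 if for every graph of the class, all positive edge weights, every start vertex and every way of breaking ties it terminates and produces a closed walk from $s$ that visits every vertex and is at most $c$ times as long as a shortest closed walk from $s$ that visits every vertex. A *unicyclic graph* is a connected graph that contains exactly one cycle. **Theorem.** On unicyclic graphs, $\mathrm{Blocking}_\delta$ is $(4+2\delta)$-competitive for every $\delta>0$, and $$\max\left(4+2\delta,\ 3+\frac{\delta^2+\delta/2}{1+\delta}\right)\text{-competitive}$$ for every $-1<\delta\le 0$. In particular, it is $3$-competitive for $\delta=-\tfrac12$. -/

import Mathlib

namespace GraphExploration

variable {V : Type*}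

/-- A connected graph with exactly one cycle. Closed walks that differ only in their base point or
orientation trace the same cycle, so cycles are identified with their edge sets. -/
def IsUnicyclic (G : SimpleGraph V) : Prop :=
  G.Connected ∧
    ∃! C : Set (Sym2 V), ∃ (v : V) (p : G.Walk v v), p.IsCycle ∧ C = {e | e ∈ p.edges}

/-- The length of a walk: the sum of the weights of its edges, counted with multiplicity. -/
def walkLength (w : Sym2 V → ℝ) {G : SimpleGraph V} {x y : V} (p : G.Walk x y) : ℝ :=
  (p.edges.map w).sum

/-- `p` is a shortest path of `G` with respect to the edge weights `w`. -/
def IsShortestPath (w : Sym2 V → ℝ) {G : SimpleGraph V} {x y : V} (p : G.Walk x y) : Prop :=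
  p.IsPath ∧ ∀ q : G.Walk x y, walkLength w p ≤ walkLength w q

/-- A closed walk from `s` to `s` that visits every vertex. -/
def IsTour {G : SimpleGraph V} {s t : V} (T : G.Walk s t) : Prop :=
  t = s ∧ ∀ v : V, v ∈ T.support

/-! In what follows `H : List V` is the list of the vertices explored so far, latest first. -/

/-- The part of `G` revealed to the searcher: all edges with at least one explored endpoint. -/
def knownGraph (G : SimpleGraph V) (H : List V) : SimpleGraph V where
  Adj x y := G.Adj x y ∧ (x ∈ H ∨ y ∈ H)
  symm := ⟨fun _ _ h => ⟨h.1.symm, h.2.symm⟩⟩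
  loopless := ⟨fun x h => G.loopless.irrefl x h.1⟩

theorem knownGraph_le (G : SimpleGraph V) (H : List V) : knownGraph G H ≤ G :=
  fun _ _ h => h.1

/-- `(u, v)` is a boundary edge: `u` is explored and `v` is not. -/
def IsBoundary (G : SimpleGraph V) (H : List V) (u v : V) : Prop :=
  G.Adj u v ∧ u ∈ H ∧ v ∉ H

/-- The blocking condition: the boundary edge `(u, v)` is blocked by the boundary edge `(u', v')`
if the latter is shorter and a shortest known path from `u` to `v'` has length at most
`(1 + δ) |(u, v)|`. -/
def BlockedBy (G : SimpleGraph V) (w : Sym2 V → ℝ) (δ : ℝ) (H : List V) (u v u' v' : V) : Prop :=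
  IsBoundary G H u v ∧ IsBoundary G H u' v' ∧ w s(u', v') < w s(u, v) ∧
    ∃ p : (knownGraph G H).Walk u v',
      IsShortestPath w p ∧ walkLength w p ≤ (1 + δ) * w s(u, v)

/-- The loop condition of the call `Blocking(G, y)`: `(u, v)` is a boundary edge that is currently
not blocked, and either `u = y` or `(u, v)` was blocked by some edge `(u', y)` at an earlier time.
The earlier lists of explored vertices are the suffixes of `H`. -/
def Eligible (G : SimpleGraph V) (w : Sym2 V → ℝ) (δ : ℝ) (H : List V) (y u v : V) : Prop :=
  IsBoundary G H u v ∧ (¬ ∃ u' v', BlockedBy G w δ H u v u' v') ∧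
    (u = y ∨ ∃ (H' : List V) (u' : V), H' <:+ H ∧ BlockedBy G w δ H' u v u' y)

/-- A configuration of the recursive procedure at the head of the while loop of the call
`Blocking(G, current)`; the searcher is at `current`. -/
structure Config (G : SimpleGraph V) (s : V) where
  /-- the explored vertices, latest first -/
  explored : List V
  /-- the vertex whose call is being executed -/
  current : V
  /-- the vertices whose calls are suspended, innermost call first -/
  callers : List V
  /-- the route of the searcher so far -/
  tour : G.Walk s current

/-- The start of the call `Blocking(G, s)`. -/
def Config.init (G : SimpleGraph V) (s : V) : Config G s :=
  ⟨[s], s, [], SimpleGraph.Walk.nil⟩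

/-- One step of the procedure `Blocking` with parameter `δ`. All ties, among edges and among
shortest paths, may be broken arbitrarily. -/
inductive Step (G : SimpleGraph V) (w : Sym2 V → ℝ) (δ : ℝ) (s : V) :
    Config G s → Config G s → Prop
  /-- The loop of the call at `y` picks `(u, v)`: walk a shortest known path from `y` to `u`,
  traverse `(u, v)`, and start the call at `v`. -/
  | explore {H K : List V} {y u v : V} (T : G.Walk s y)
      (he : Eligible G w δ H y u v)
      (p : (knownGraph G H).Walk y u) (hp : IsShortestPath w p) :
      Step G w δ s ⟨H, y, K, T⟩
        ⟨v :: H, v, y :: K, (T.append (p.mapLe (knownGraph_le G H))).concat he.1.1⟩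
  /-- The loop of the call at `v` is over: this call ends and its caller, the call at `y`, walks a
  shortest known path from `v` back to `y`. -/
  | backtrack {H K : List V} {v y : V} (T : G.Walk s v)
      (he : ∀ a b, ¬ Eligible G w δ H v a b)
      (p : (knownGraph G H).Walk v y) (hp : IsShortestPath w p) :
      Step G w δ s ⟨H, v, y :: K, T⟩
        ⟨H, y, K, T.append (p.mapLe (knownGraph_le G H))⟩

/-- `Blocking` with parameter `δ` is `c`-competitive on the instance `(G, w, s)`: it always
terminates, and whenever it has terminated, the searcher has made a tour that is at most `c` times
as long as any tour of the graph, in particular as an optimal one. -/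
def BlockingCompetitive (G : SimpleGraph V) (w : Sym2 V → ℝ) (s : V) (δ c : ℝ) : Prop :=
  (¬ ∃ f : ℕ → Config G s, f 0 = Config.init G s ∧ ∀ n, Step G w δ s (f n) (f (n + 1))) ∧
    ∀ A : Config G s, Relation.ReflTransGen (Step G w δ s) (Config.init G s) A →
      (∀ B, ¬ Step G w δ s A B) →
        IsTour A.tour ∧
          ∀ T : G.Walk s s, IsTour T → walkLength w A.tour ≤ c * walkLength w T

end GraphExploration

/-!
Fix a unicyclic graph of total weight `W`. Call an edge `g` of the cycle *dominant* if it is heavier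
than the rest of the graph, that is, `R < |g|` for `R = W - |g|`.

*Lower bound.* A tour that uses every edge has length at least `W`. A tour that avoids some edge `g`
is a tour of the tree `G - g`, so `g` lies on the cycle and every other edge is used at least twice;
the tour has length at least `2 (W - |g|)`. Hence every tour has length at least `2 R` if there is a
dominant edge and at least `W` otherwise (`totalWeight_le_or_of_isTour`).

*Cost of an ordinary edge.* If the call at `y` explores `e = (u, v)`, then `y = u` or `e` was blocked
by an edge ending in `y`. So `y` is within `(1 + δ) |e|` of `u`, and going to the far end of `e` and
back costs at most `(4 + 2δ) |e|`. Every edge is explored at most once, which settles the case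
without a dominant edge.

*Cost of a dominant edge.* Let `g = (u, v)` be dominant and explored from `y`, and let `r ≤ R` be the
length of the path `P` from `u` to `v` in `G - g`. The boundary edge on `P` is lighter than `g` and
does not block it, so `(1 + δ) |g| < r` (`lt_walkLength_of_isDominant`); in particular `δ < 0`. The
way from `y` to `u` is shorter than `g` and stays in the tree `G - g`. By the time the call at `v`
ends, the whole cycle is known (`Consistent.reachable_of_isDominant`), so the way back is at most as
long as the path from `v` to `y` in this tree. The paths between `y`, `u` and `v` in the tree use
every edge at most twice together (`walkLength_triangle_le`), so the cost of exploring `g` is at most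
`|g| + 2 R - r ≤ (2 + δ) / (1 + δ) * R`. With the cost `(4 + 2δ) R` of the other edges, this is
`3 + (δ² + δ/2) / (1 + δ)` times `2 R`.

*Completeness.* Both the knowledge of the cycle and the fact that all vertices get explored rest on
`Consistent.exists_eligible`: a boundary edge that is not blocked is always eligible for some active
call. At the end, a lightest boundary edge would not be blocked, but no call is left for it.
-/

namespace GraphExploration

variable {V : Type*} {G G' : SimpleGraph V} {w : Sym2 V → ℝ} {δ : ℝ}

/-! ### Lengths of walks -/

@[simp]
theorem walkLength_nil (w : Sym2 V → ℝ) (x : V) :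
    walkLength w (SimpleGraph.Walk.nil : G.Walk x x) = 0 := by
  simp [walkLength]

@[simp]
theorem walkLength_append (w : Sym2 V → ℝ) {x y z : V} (p : G.Walk x y) (q : G.Walk y z) :
    walkLength w (p.append q) = walkLength w p + walkLength w q := by
  simp [walkLength]

@[simp]
theorem walkLength_concat (w : Sym2 V → ℝ) {x y z : V} (p : G.Walk x y) (h : G.Adj y z) :
    walkLength w (p.concat h) = walkLength w p + w s(y, z) := by
  simp [walkLength]

@[simp]
theorem walkLength_reverse (w : Sym2 V → ℝ) {x y : V} (p : G.Walk x y) :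
    walkLength w p.reverse = walkLength w p := by
  simp [walkLength, List.sum_reverse]

theorem walkLength_congr (w : Sym2 V → ℝ) {x y x' y' : V} {p : G.Walk x y} {q : G'.Walk x' y'}
    (h : p.edges = q.edges) : walkLength w p = walkLength w q := by
  simp [walkLength, h]

@[simp]
theorem walkLength_mapLe (w : Sym2 V → ℝ) (h : G ≤ G') {x y : V} (p : G.Walk x y) :
    walkLength w (p.mapLe h) = walkLength w p :=
  walkLength_congr w (SimpleGraph.Walk.edges_mapLe_eq_edges h p)

theorem sum_map_le_of_sublist {l l' : List (Sym2 V)} (h : l.Sublist l')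
    (hw : ∀ e ∈ l', 0 ≤ w e) : (l.map w).sum ≤ (l'.map w).sum := by
  refine List.Sublist.sum_le_sum (h.map w) ?_
  simpa using hw

theorem walkLength_nonneg (hw : ∀ e ∈ G.edgeSet, 0 ≤ w e) {x y : V} (p : G.Walk x y) :
    0 ≤ walkLength w p := by
  refine List.sum_nonneg ?_
  simpa using fun e he => hw e (p.edges_subset_edgeSet he)

theorem le_walkLength_of_mem_edges (hw : ∀ e ∈ G.edgeSet, 0 ≤ w e) {x y : V} (p : G.Walk x y)
    {e : Sym2 V} (he : e ∈ p.edges) : w e ≤ walkLength w p := by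
  simpa [walkLength] using sum_map_le_of_sublist (List.singleton_sublist.2 he)
    (fun f hf => hw f (p.edges_subset_edgeSet hf))

theorem exists_isShortestPath [Finite V] (hw : ∀ e ∈ G.edgeSet, 0 ≤ w e) {x y : V}
    (h : G.Reachable x y) : ∃ p : G.Walk x y, IsShortestPath w p := by
  classical
  cases nonempty_fintype V
  have : DecidableRel G.Adj := Classical.decRel _
  obtain ⟨p₀⟩ := h
  have : Nonempty (G.Path x y) := ⟨p₀.toPath⟩
  obtain ⟨p, hp⟩ := Finite.exists_min fun p : G.Path x y => walkLength w p.1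
  refine ⟨p.1, p.2, fun q => (hp q.toPath).trans ?_⟩
  exact sum_map_le_of_sublist q.edges_bypass_sublist_edges
    fun e he => hw e (q.edges_subset_edgeSet he)

/-- The set of edges of a finite graph, as a finset. -/
noncomputable def edges [Finite V] (G : SimpleGraph V) : Finset (Sym2 V) :=
  (Set.toFinite G.edgeSet).toFinset

@[simp]
theorem mem_edges [Finite V] {e : Sym2 V} : e ∈ edges G ↔ e ∈ G.edgeSet := by
  simp [edges]

/-- The sum of the weights of all edges. -/
noncomputable def totalWeight [Finite V] (G : SimpleGraph V) (w : Sym2 V → ℝ) : ℝ :=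
  ∑ e ∈ edges G, w e

theorem totalWeight_deleteEdges [Finite V] {e : Sym2 V} (he : e ∈ G.edgeSet) :
    totalWeight (G.deleteEdges {e}) w = totalWeight G w - w e := by
  classical
  have : edges (G.deleteEdges {e}) = (edges G).erase e := by
    ext f
    simp [and_comm]
  rw [totalWeight, this, totalWeight, Finset.sum_erase_eq_sub (by simpa using he)]

theorem nonneg_of_le (h : G' ≤ G) (hw : ∀ e ∈ G.edgeSet, 0 ≤ w e) : ∀ e ∈ G'.edgeSet, 0 ≤ w e :=
  fun e he => hw e (SimpleGraph.edgeSet_mono h he)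

theorem sum_map_eq_sum_count [DecidableEq V] {l : List (Sym2 V)} {F : Finset (Sym2 V)}
    (h : ∀ e ∈ l, e ∈ F) : (l.map w).sum = ∑ e ∈ F, (l.count e : ℝ) * w e := by
  rw [Finset.sum_list_map_count]
  simp only [nsmul_eq_mul]
  refine Finset.sum_subset (fun e he => h e (by simpa using he)) fun e _ he => ?_
  simp [List.count_eq_zero_of_not_mem (by simpa using he)]

/-- A walk that uses every edge of `G'` at least `k` times is at least `k` times as long as the
total weight of `G'`. -/
theorem mul_totalWeight_le_walkLength [Finite V] [DecidableEq V] (hw : ∀ e ∈ G.edgeSet, 0 ≤ w e)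
    (hle : G' ≤ G) {x y : V} (p : G.Walk x y) (k : ℕ)
    (h : ∀ e ∈ G'.edgeSet, k ≤ p.edges.count e) : k * totalWeight G' w ≤ walkLength w p := by
  rw [walkLength, sum_map_eq_sum_count (F := edges G)
    (fun e he => mem_edges.2 (p.edges_subset_edgeSet he)), totalWeight, Finset.mul_sum]
  refine (Finset.sum_le_sum fun e he => ?_).trans (Finset.sum_le_sum_of_subset_of_nonneg
    (fun e he => mem_edges.2 (SimpleGraph.edgeSet_mono hle (mem_edges.1 he))) fun e he _ => ?_)
  · have he := mem_edges.1 he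
    exact mul_le_mul_of_nonneg_right (by exact_mod_cast h e he)
      (hw e (SimpleGraph.edgeSet_mono hle he))
  · exact mul_nonneg (by positivity) (hw e (mem_edges.1 he))

theorem walkLength_le_totalWeight [Finite V] (hw : ∀ e ∈ G.edgeSet, 0 ≤ w e) {x y : V}
    {p : G.Walk x y} (hp : p.IsPath) : walkLength w p ≤ totalWeight G w := by
  classical
  rw [walkLength, sum_map_eq_sum_count (F := edges G)
    (fun e he => mem_edges.2 (p.edges_subset_edgeSet he)), totalWeight]
  refine Finset.sum_le_sum fun e he => mul_le_of_le_one_left (hw e (mem_edges.1 he)) ?_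
  exact_mod_cast List.nodup_iff_count_le_one.1 hp.isTrail.edges_nodup e

/-! ### Paths and tours in trees -/

theorem reachable_deleteEdges_of_notMem {e : Sym2 V} {x y : V} (p : G.Walk x y)
    (he : e ∉ p.edges) : (G.deleteEdges {e}).Reachable x y :=
  ⟨p.toDeleteEdge e he⟩

/-- After the deletion of an edge, every vertex still reaches one of its ends. -/
theorem reachable_deleteEdges_or (hG : G.Connected) (c d x : V) :
    (G.deleteEdges {s(c, d)}).Reachable x c ∨ (G.deleteEdges {s(c, d)}).Reachable x d := by
  obtain ⟨p⟩ := hG.preconnected x c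
  suffices ∀ {y : V}, G.Walk x y → (y = c ∨ y = d) →
      (G.deleteEdges {s(c, d)}).Reachable x c ∨ (G.deleteEdges {s(c, d)}).Reachable x d from
    this p (Or.inl rfl)
  clear p
  intro y p hy
  induction p with
  | nil => rcases hy with rfl | rfl <;> simp
  | @cons x z _ h _ ih =>
    by_cases hx : s(x, z) = s(c, d)
    · rcases Sym2.eq_iff.1 hx with ⟨rfl, _⟩ | ⟨rfl, _⟩ <;> simp
    · have hxz : (G.deleteEdges {s(c, d)}).Reachable x z :=
        SimpleGraph.Adj.reachable (SimpleGraph.deleteEdges_adj.2 ⟨h, hx⟩)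
      exact (ih hy).imp hxz.trans hxz.trans

theorem eq_of_isAcyclic_of_isPath (hG : G.IsAcyclic) {x y : V} {p q : G.Walk x y} (hp : p.IsPath)
    (hq : q.IsPath) : p = q :=
  congrArg Subtype.val ((hG.subsingleton_path x y).elim ⟨p, hp⟩ ⟨q, hq⟩)

theorem not_reachable_deleteEdges_of_mem_edges (hG : G.IsAcyclic) {x y : V} {p : G.Walk x y}
    (hp : p.IsPath) {e : Sym2 V} (he : e ∈ p.edges) : ¬ (G.deleteEdges {e}).Reachable x y := by
  classical
  rintro ⟨q⟩
  have h := eq_of_isAcyclic_of_isPath hG hp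
    ((SimpleGraph.Walk.isPath_mapLe (G.deleteEdges_le {e})).2 q.bypass_isPath)
  rw [h, SimpleGraph.Walk.edges_mapLe_eq_edges] at he
  simpa using SimpleGraph.Walk.edges_subset_edgeSet _ he

/-- The three paths between three vertices of a tree together use every edge at most twice, since
the deletion of an edge leaves only two components. -/
theorem walkLength_triangle_le [Finite V] (hG : G.IsTree) (hw : ∀ e ∈ G.edgeSet, 0 ≤ w e)
    {x y z : V} {p : G.Walk x y} {q : G.Walk y z} {r : G.Walk z x} (hp : p.IsPath)
    (hq : q.IsPath) (hr : r.IsPath) :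
    walkLength w p + walkLength w q + walkLength w r ≤ 2 * totalWeight G w := by
  classical
  have key : ∀ {x y : V} (p : G.Walk x y), walkLength w p =
      ∑ e ∈ edges G, (p.edges.count e : ℝ) * w e := fun p => by
    rw [walkLength, sum_map_eq_sum_count fun e he => mem_edges.2 (p.edges_subset_edgeSet he)]
  rw [key p, key q, key r, totalWeight, Finset.mul_sum, ← Finset.sum_add_distrib,
    ← Finset.sum_add_distrib]
  refine Finset.sum_le_sum fun e he => ?_
  rw [← add_mul, ← add_mul]
  refine mul_le_mul_of_nonneg_right ?_ (hw e (mem_edges.1 he))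
  have h1 := List.nodup_iff_count_le_one.1 hp.isTrail.edges_nodup e
  have h2 := List.nodup_iff_count_le_one.1 hq.isTrail.edges_nodup e
  have h3 := List.nodup_iff_count_le_one.1 hr.isTrail.edges_nodup e
  suffices p.edges.count e + q.edges.count e + r.edges.count e ≤ 2 by exact_mod_cast this
  by_contra! hcon
  have m1 := not_reachable_deleteEdges_of_mem_edges hG.isAcyclic hp
    (List.count_pos_iff.1 (by omega : 0 < p.edges.count e))
  have m2 := not_reachable_deleteEdges_of_mem_edges hG.isAcyclic hq
    (List.count_pos_iff.1 (by omega : 0 < q.edges.count e))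
  have m3 := not_reachable_deleteEdges_of_mem_edges hG.isAcyclic hr
    (List.count_pos_iff.1 (by omega : 0 < r.edges.count e))
  induction e with
  | h c d =>
    rcases reachable_deleteEdges_or hG.connected c d x with hx | hx <;>
    rcases reachable_deleteEdges_or hG.connected c d y with hy | hy <;>
    rcases reachable_deleteEdges_or hG.connected c d z with hz | hz <;>
    first
      | exact m1 (hx.trans hy.symm)
      | exact m2 (hy.trans hz.symm)
      | exact m3 (hz.trans hx.symm)

/-- A tour crosses every edge of a tree at least twice: on its way to the far end of the edge, and
on its way back. -/
theorem two_le_count_of_isTour [DecidableEq V] (hG : G.IsAcyclic) {s : V} {T : G.Walk s s}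
    (hT : IsTour T) {e : Sym2 V} (he : e ∈ G.edgeSet) : 2 ≤ T.edges.count e := by
  have hbr := SimpleGraph.isAcyclic_iff_forall_isBridge.1 hG he
  obtain ⟨x, hx⟩ : ∃ x, ¬ (G.deleteEdges {e}).Reachable s x := by
    induction e with
    | h c d =>
      by_contra! h
      exact SimpleGraph.isBridge_iff.1 hbr ((h c).symm.trans (h d))
  have hmem := hT.2 x
  rw [← T.take_spec hmem, SimpleGraph.Walk.edges_append, List.count_append]
  have h1 : 0 < (T.takeUntil x hmem).edges.count e := by
    rw [List.count_pos_iff]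
    by_contra h
    exact hx (reachable_deleteEdges_of_notMem _ h)
  have h2 : 0 < (T.dropUntil x hmem).edges.count e := by
    rw [List.count_pos_iff]
    by_contra h
    exact hx (reachable_deleteEdges_of_notMem _ h).symm
  omega

/-- Deleting an edge that a tour avoids turns a unicyclic graph into a tree. -/
theorem isTree_deleteEdges_of_notMem_edges (hG : IsUnicyclic G) {s : V} {T : G.Walk s s}
    (hT : IsTour T) {g : Sym2 V} (hg : g ∈ G.edgeSet) (hgT : g ∉ T.edges) :
    (G.deleteEdges {g}).IsTree := by
  classical
  have hreach : ∀ x, (G.deleteEdges {g}).Reachable s x := fun x =>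
    reachable_deleteEdges_of_notMem (T.takeUntil x (hT.2 x))
      fun h => hgT (T.edges_takeUntil_subset_edges _ h)
  have : Nonempty V := ⟨s⟩
  refine ⟨⟨fun x y => (hreach x).symm.trans (hreach y)⟩, ?_⟩
  intro v c hc
  obtain ⟨u, c', hc', hgc'⟩ : ∃ (u : V) (p : G.Walk u u), p.IsCycle ∧ g ∈ p.edges := by
    induction g with
    | h a b =>
      exact SimpleGraph.adj_and_reachable_delete_edges_iff_exists_cycle.1
        ⟨hg, (hreach a).symm.trans (hreach b)⟩
  have heq := hG.2.unique ⟨u, c', hc', rfl⟩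
    ⟨v, c.mapLe (G.deleteEdges_le _), (SimpleGraph.Walk.isCycle_mapLe _).2 hc, rfl⟩
  have hgc : g ∈ c.edges := by
    have : g ∈ {e | e ∈ c'.edges} := hgc'
    rw [heq] at this
    simpa only [Set.mem_ofPred_eq, SimpleGraph.Walk.edges_mapLe_eq_edges] using this
  simpa using c.edges_subset_edgeSet hgc

theorem totalWeight_le_or_of_isTour [Finite V] (hG : IsUnicyclic G)
    (hw : ∀ e ∈ G.edgeSet, 0 ≤ w e) {s : V} {T : G.Walk s s} (hT : IsTour T) :
    totalWeight G w ≤ walkLength w T ∨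
      ∃ g ∈ G.edgeSet, (G.deleteEdges {g}).IsTree ∧
        2 * (totalWeight G w - w g) ≤ walkLength w T := by
  classical
  by_cases h : ∀ g ∈ G.edgeSet, g ∈ T.edges
  · left
    simpa using mul_totalWeight_le_walkLength hw le_rfl T 1
      fun e he => List.count_pos_iff.2 (h e he)
  · right
    push Not at h
    obtain ⟨g, hg, hgT⟩ := h
    have htree := isTree_deleteEdges_of_notMem_edges hG hT hg hgT
    refine ⟨g, hg, htree, ?_⟩
    have hT' : IsTour (T.toDeleteEdge g hgT) := ⟨rfl, fun v => by simpa using hT.2 v⟩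
    have := mul_totalWeight_le_walkLength (nonneg_of_le (G.deleteEdges_le {g}) hw) le_rfl
      (T.toDeleteEdge g hgT) 2 fun e he => two_le_count_of_isTour htree.isAcyclic hT' he
    rw [totalWeight_deleteEdges hg, walkLength_congr w (q := T) (by simp)] at this
    simpa using this

/-! ### The known graph and blocked edges -/

theorem knownGraph_mono {H H' : List V} (h : H ⊆ H') : knownGraph G H ≤ knownGraph G H' :=
  fun _ _ hxy => ⟨hxy.1, hxy.2.imp (fun hx => h hx) (fun hy => h hy)⟩

/-- A walk through explored vertices is known, and avoids every edge with an unexplored end. -/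
theorem reachable_of_support_subset {H H' : List V} {x y b : V} {g : Sym2 V} (p : G.Walk x y)
    (hp : ∀ z ∈ p.support, z ∈ H) (hH : H ⊆ H') (hb : b ∉ H) (hg : b ∈ g) :
    ((knownGraph G H').deleteEdges {g}).Reachable x y := by
  refine ⟨p.transfer _ fun e he => ?_⟩
  have heG := p.edges_subset_edgeSet he
  induction e with
  | h c d =>
    have hc := hp c (p.fst_mem_support_of_mem_edges he)
    have hd := hp d (p.snd_mem_support_of_mem_edges he)
    refine SimpleGraph.deleteEdges_adj.2 ⟨⟨heG, Or.inl (hH hc)⟩, ?_⟩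
    rintro rfl
    rcases Sym2.mem_iff.1 hg with rfl | rfl
    · exact hb hc
    · exact hb hd

/-- A walk that leaves the explored vertices passes a boundary edge, and the part of it up to there
is known. -/
theorem exists_isBoundary_of_walk {H : List V} (hle : G' ≤ G) {a b : V} (p : G'.Walk a b)
    (ha : a ∈ H) (hb : b ∉ H) :
    ∃ x z, IsBoundary G H x z ∧ s(x, z) ∈ p.edges ∧
      ∃ q : (knownGraph G H).Walk a z, q.edges.Sublist p.edges := by
  induction p with
  | nil => exact absurd ha hb
  | @cons a c b h p ih =>
    have hac : (knownGraph G H).Adj a c := ⟨hle h, Or.inl ha⟩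
    by_cases hc : c ∈ H
    · obtain ⟨x, z, hxz, hmem, q, hq⟩ := ih hc hb
      exact ⟨x, z, hxz, by simp [hmem], .cons hac q, by simpa using hq⟩
    · exact ⟨a, c, ⟨hle h, ha, hc⟩, by simp, .cons hac .nil, by simp⟩

theorem exists_isBoundary (hG : G.Connected) {H : List V} {s v : V} (hs : s ∈ H) (hv : v ∉ H) :
    ∃ x z, IsBoundary G H x z := by
  obtain ⟨p⟩ := hG.preconnected s v
  obtain ⟨x, z, h, -⟩ := exists_isBoundary_of_walk le_rfl p hs hv
  exact ⟨x, z, h⟩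

/-- Among the boundary edges with some property there is a lightest one. -/
theorem exists_lightest_isBoundary [Finite V] (w : Sym2 V → ℝ) {H : List V} {P : V → V → Prop}
    (h : ∃ a b, IsBoundary G H a b ∧ P a b) :
    ∃ a b, IsBoundary G H a b ∧ P a b ∧
      ∀ x z, IsBoundary G H x z → P x z → w s(a, b) ≤ w s(x, z) := by
  obtain ⟨a, b, hab⟩ := h
  obtain ⟨e, he, hmin⟩ := Set.exists_min_image {e : V × V | IsBoundary G H e.1 e.2 ∧ P e.1 e.2}
    (fun e => w s(e.1, e.2)) (Set.toFinite _) ⟨(a, b), hab⟩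
  exact ⟨e.1, e.2, he.1, he.2, fun x z hx hP => hmin (x, z) ⟨hx, hP⟩⟩

theorem BlockedBy.cons [Finite V] (hw : ∀ e ∈ G.edgeSet, 0 ≤ w e) {H : List V} {u v u' v' x : V}
    (h : BlockedBy G w δ H u v u' v') (hv : v ≠ x) (hv' : v' ≠ x) :
    BlockedBy G w δ (x :: H) u v u' v' := by
  obtain ⟨⟨h1, h2, h3⟩, ⟨h4, h5, h6⟩, hlt, p, -, hp⟩ := h
  have hle : knownGraph G H ≤ knownGraph G (x :: H) := knownGraph_mono (by simp)
  obtain ⟨q, hq⟩ := exists_isShortestPath (nonneg_of_le (knownGraph_le G (x :: H)) hw)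
    (p.mapLe hle).reachable
  refine ⟨⟨h1, by simp [h2], by simp [hv, h3]⟩, ⟨h4, by simp [h5], by simp [hv', h6]⟩, hlt, q, hq,
    ((hq.2 _).trans_eq (walkLength_mapLe w hle p)).trans hp⟩

/-- If a boundary edge was blocked at some earlier time and is not blocked now, then it ceased to be
blocked when the far end `z` of an edge blocking it was explored, and it has not been blocked
since. -/
theorem exists_last_blockedBy [Finite V] (hw : ∀ e ∈ G.edgeSet, 0 ≤ w e) {H H₀ : List V} {u v : V}
    (hv : v ∉ H) (hH : ¬ ∃ u' v', BlockedBy G w δ H u v u' v') (hH₀ : H₀ <:+ H)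
    (hb : ∃ u' v', BlockedBy G w δ H₀ u v u' v') :
    ∃ H₁ u' z, z :: H₁ <:+ H ∧ BlockedBy G w δ H₁ u v u' z ∧
      ∀ H₂, z :: H₁ <:+ H₂ → H₂ <:+ H → ¬ ∃ u' v', BlockedBy G w δ H₂ u v u' v' := by
  induction H with
  | nil => exact absurd (List.suffix_nil.1 hH₀ ▸ hb) hH
  | cons x H ih =>
    have hvx : v ≠ x ∧ v ∉ H := by simpa using hv
    by_cases h : ∃ u' v', BlockedBy G w δ H u v u' v'
    · obtain ⟨u', z, hz⟩ := h
      -- An edge that blocks goes on blocking as long as its far end stays unexplored.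
      by_cases hzx : z = x
      · subst hzx
        refine ⟨H, u', z, List.suffix_rfl, hz, fun H₂ h1 h2 => ?_⟩
        rwa [h2.eq_of_length_le h1.length_le]
      · exact absurd ⟨u', z, hz.cons hw hvx.1 hzx⟩ hH
    · have hH₀' : H₀ <:+ H := by
        rcases List.suffix_cons_iff.1 hH₀ with rfl | h'
        · exact absurd hb hH
        · exact h'
      obtain ⟨H₁, u', z, h1, h2, h3⟩ := ih hvx.2 h hH₀'
      refine ⟨H₁, u', z, h1.trans (List.suffix_cons x H), h2, fun H₂ h4 h5 => ?_⟩
      rcases List.suffix_cons_iff.1 h5 with rfl | h'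
      · exact hH
      · exact h3 H₂ h4 h'

/-! ### Every unblocked boundary edge is eligible for an active call -/

/-- The invariant of the procedure that does not concern lengths. In particular, every call that is
not active any more has ended, at a time when no edge was eligible for it. -/
structure Consistent (G : SimpleGraph V) (w : Sym2 V → ℝ) (δ : ℝ) {s : V} (A : Config G s) :
    Prop where
  getLast : (A.current :: A.callers).getLast? = some s
  active : ∀ x ∈ A.current :: A.callers, x ∈ A.explored
  joined : ∀ x ∈ A.explored, ∃ p : G.Walk s x, ∀ y ∈ p.support, y ∈ A.explored
  visited : ∀ x ∈ A.explored, x ∈ A.tour.support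
  ended : ∀ x ∈ A.explored, x ∈ A.current :: A.callers ∨
    ∃ H, H <:+ A.explored ∧ x ∈ H ∧ ∀ a b, ¬ Eligible G w δ H x a b

theorem Consistent.init (s : V) : Consistent G w δ (Config.init G s) where
  getLast := rfl
  active := by simp [Config.init]
  joined := by
    intro x hx
    obtain rfl : x = s := by simpa [Config.init] using hx
    exact ⟨.nil, by simp [Config.init]⟩
  visited := by simp [Config.init]
  ended := by
    intro x hx
    left
    simpa [Config.init] using hx

theorem Consistent.step {s : V} {A B : Config G s} (hA : Consistent G w δ A)
    (h : Step G w δ s A B) : Consistent G w δ B := by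
  cases h with
  | @explore H K y u v T he p hp =>
    refine ⟨?_, ?_, ?_, ?_, ?_⟩
    · simpa [List.getLast?_cons_cons] using hA.getLast
    · intro x hx
      rcases List.mem_cons.1 hx with rfl | hx
      · simp
      · exact List.mem_cons_of_mem _ (hA.active x hx)
    · intro x hx
      rcases List.mem_cons.1 hx with rfl | hx
      · obtain ⟨q, hq⟩ := hA.joined u he.1.2.1
        refine ⟨q.concat he.1.1, fun z hz => ?_⟩
        rw [SimpleGraph.Walk.support_concat, List.mem_append] at hz
        rcases hz with hz | hz
        · exact List.mem_cons_of_mem _ (hq z hz)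
        · exact List.mem_cons.2 (Or.inl (by simpa using hz))
      · obtain ⟨q, hq⟩ := hA.joined x hx
        exact ⟨q, fun z hz => List.mem_cons_of_mem _ (hq z hz)⟩
    · intro x hx
      rcases List.mem_cons.1 hx with rfl | hx
      · exact SimpleGraph.Walk.end_mem_support _
      · have := hA.visited x hx
        simp only [SimpleGraph.Walk.support_concat, List.mem_append,
          SimpleGraph.Walk.mem_support_append_iff]
        exact Or.inl (Or.inl this)
    · intro x hx
      rcases List.mem_cons.1 hx with rfl | hx
      · simp
      · rcases hA.ended x hx with h | ⟨H', h1, h2⟩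
        · exact Or.inl (List.mem_cons_of_mem _ h)
        · exact Or.inr ⟨H', h1.trans (List.suffix_cons _ _), h2⟩
  | @backtrack H K v y T he p hp =>
    refine ⟨?_, ?_, hA.joined, ?_, ?_⟩
    · simpa [List.getLast?_cons_cons] using hA.getLast
    · exact fun x hx => hA.active x (List.mem_cons_of_mem _ hx)
    · intro x hx
      rw [SimpleGraph.Walk.mem_support_append_iff]
      exact Or.inl (hA.visited x hx)
    · intro x hx
      rcases hA.ended x hx with h | h
      · rcases List.mem_cons.1 h with rfl | h
        · exact Or.inr ⟨H, List.suffix_rfl, hx, he⟩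
        · exact Or.inl h
      · exact Or.inr h

/-- A call that has ended cannot have left behind an edge for which it was responsible: the call at
the vertex whose exploration unblocked the edge for the last time, or the call at the explored end
of an edge that was never blocked, would not have ended. -/
theorem Consistent.exists_eligible [Finite V] (hw : ∀ e ∈ G.edgeSet, 0 ≤ w e) {s : V}
    {A : Config G s} (hA : Consistent G w δ A) {u v : V} (hb : IsBoundary G A.explored u v)
    (hun : ¬ ∃ u' v', BlockedBy G w δ A.explored u v u' v') :
    ∃ z ∈ A.current :: A.callers, Eligible G w δ A.explored z u v := by
  by_cases hbl : ∃ H₀, H₀ <:+ A.explored ∧ ∃ u' v', BlockedBy G w δ H₀ u v u' v'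
  · obtain ⟨H₀, hH₀, hbl⟩ := hbl
    obtain ⟨H₁, u', z, h1, h2, h3⟩ := exists_last_blockedBy hw hb.2.2 hun hH₀ hbl
    have hsuf := (List.suffix_cons z H₁)
    rcases hA.ended z (h1.subset (by simp)) with hz | ⟨H₂, hH₂, hz, hnot⟩
    · exact ⟨z, hz, hb, hun, Or.inr ⟨H₁, u', hsuf.trans h1, h2⟩⟩
    · have h4 : z :: H₁ <:+ H₂ := by
        rcases List.suffix_or_suffix_of_suffix h1 hH₂ with h | h
        · exact h
        · rcases List.suffix_cons_iff.1 h with rfl | h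
          · exact List.suffix_rfl
          · exact absurd (h.subset hz) h2.2.1.2.2
      exact absurd ⟨⟨hb.1, (hsuf.trans h4).subset h2.1.2.1, fun h => hb.2.2 (hH₂.subset h)⟩,
        h3 H₂ h4 hH₂, Or.inr ⟨H₁, u', hsuf.trans h4, h2⟩⟩ (hnot u v)
  · rcases hA.ended u hb.2.1 with hu | ⟨H₂, hH₂, hu, hnot⟩
    · exact ⟨u, hu, hb, hun, Or.inl rfl⟩
    · exact absurd ⟨⟨hb.1, hu, fun h => hb.2.2 (hH₂.subset h)⟩,
        fun h => hbl ⟨H₂, hH₂, h⟩, Or.inl rfl⟩ (hnot u v)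

theorem Consistent.reachable {s : V} {A : Config G s} (hA : Consistent G w δ A) {x y : V}
    (hx : x ∈ A.explored) (hy : y ∈ A.explored) : (knownGraph G A.explored).Reachable x y := by
  have key : ∀ z ∈ A.explored, (knownGraph G A.explored).Reachable s z := fun z hz => by
    obtain ⟨p, hp⟩ := hA.joined z hz
    exact ⟨p.transfer _ fun e he => by
      induction e with
      | h c d => exact ⟨p.edges_subset_edgeSet he,
          Or.inl (hp c (p.fst_mem_support_of_mem_edges he))⟩⟩
  exact (key x hx).symm.trans (key y hy)

theorem Consistent.start_mem {s : V} {A : Config G s} (hA : Consistent G w δ A) :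
    s ∈ A.explored :=
  hA.active s (List.mem_of_getLast? hA.getLast)

/-! ### Termination -/

/-- The initial call ends only after all vertices have been explored. -/
theorem Consistent.isTour [Finite V] (hG : G.Connected) (hw : ∀ e ∈ G.edgeSet, 0 ≤ w e) {s : V}
    {A : Config G s} (hA : Consistent G w δ A) (hterm : ∀ B, ¬ Step G w δ s A B) :
    A.callers = [] ∧ IsTour A.tour := by
  have hw' := nonneg_of_le (knownGraph_le G A.explored) hw
  have hcur := hA.active A.current (by simp)
  have hnot : ∀ a b, ¬ Eligible G w δ A.explored A.current a b := fun a b he => by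
    obtain ⟨p, hp⟩ := exists_isShortestPath hw' (hA.reachable hcur he.1.2.1)
    exact hterm _ (Step.explore A.tour he p hp)
  have hK : A.callers = [] := by
    obtain ⟨H, c, K, T⟩ := A
    cases K with
    | nil => rfl
    | cons y K =>
      obtain ⟨p, hp⟩ := exists_isShortestPath hw' (hA.reachable hcur (hA.active y (by simp)))
      exact absurd (Step.backtrack T hnot p hp) (hterm _)
  have hlast := hA.getLast
  rw [hK] at hlast
  refine ⟨hK, by simpa using hlast, fun x => hA.visited x ?_⟩
  by_contra hx
  obtain ⟨a, b, hab⟩ := exists_isBoundary hG hA.start_mem hx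
  obtain ⟨a, b, hab, -, hmin⟩ := exists_lightest_isBoundary w (P := fun _ _ => True)
    ⟨a, b, hab, trivial⟩
  obtain ⟨z, hz, he⟩ := hA.exists_eligible hw hab fun ⟨u', v', h⟩ =>
    (hmin u' v' h.2.1 trivial).not_gt h.2.2.1
  rw [hK, List.mem_singleton] at hz
  exact hnot a b (hz ▸ he)

theorem not_exists_infinite_run [Finite V] (s : V) :
    ¬ ∃ f : ℕ → Config G s, f 0 = Config.init G s ∧ ∀ n, Step G w δ s (f n) (f (n + 1)) := by
  classical
  cases nonempty_fintype V
  rintro ⟨f, -, hf⟩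
  let μ : Config G s → ℕ := fun A =>
    2 * (Finset.univ.filter fun x => x ∉ A.explored).card + A.callers.length
  -- Exploring pushes one caller but removes an unexplored vertex; backtracking pops a caller.
  have hμ : ∀ {A B : Config G s}, Step G w δ s A B → μ B < μ A := by
    intro A B h
    cases h with
    | @explore H K y u v T he p hp =>
      have : (Finset.univ.filter fun x => x ∉ v :: H).card <
          (Finset.univ.filter fun x => x ∉ H).card := by
        refine Finset.card_lt_card (Finset.ssubset_iff_of_subset ?_ |>.2 ⟨v, ?_, ?_⟩)
        · intro x
          simp +contextual
        · simpa using he.1.2.2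
        · simp
      simp only [μ, List.length_cons]
      omega
    | backtrack => simp [μ]
  exact not_strictAnti_of_wellFoundedLT (fun n => μ (f n))
    (strictAnti_nat_of_succ_lt fun n => hμ (hf n))

/-! ### Dominant edges -/

/-- An edge whose deletion leaves a tree, so an edge of the cycle if `G` is unicyclic, and which is
heavier than all other edges of `G` together. -/
def IsDominant [Finite V] (G : SimpleGraph V) (w : Sym2 V → ℝ) (g : Sym2 V) : Prop :=
  g ∈ G.edgeSet ∧ (G.deleteEdges {g}).IsTree ∧ totalWeight G w - w g < w g

theorem weight_le_totalWeight_sub [Finite V] (hw : ∀ e ∈ G.edgeSet, 0 ≤ w e) {e g : Sym2 V}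
    (hg : g ∈ G.edgeSet) (he : e ∈ G.edgeSet) (hne : e ≠ g) : w e ≤ totalWeight G w - w g := by
  have hle := G.deleteEdges_le {g}
  rw [← totalWeight_deleteEdges hg]
  exact Finset.single_le_sum (f := w)
    (fun f hf => nonneg_of_le hle hw f (mem_edges.1 hf)) (mem_edges.2 (by simp [he, hne]))

theorem reachable_deleteEdges_of_walkLength_lt (hw : ∀ e ∈ G.edgeSet, 0 ≤ w e) {H H' : List V}
    (hH : H' ⊆ H) {x y : V} (p : (knownGraph G H').Walk x y) {g : Sym2 V}
    (hp : walkLength w p < w g) : ((knownGraph G H).deleteEdges {g}).Reachable x y := by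
  refine reachable_deleteEdges_of_notMem (p.mapLe (knownGraph_mono hH)) fun hg => ?_
  rw [SimpleGraph.Walk.edges_mapLe_eq_edges] at hg
  exact hp.not_ge (le_walkLength_of_mem_edges (nonneg_of_le (knownGraph_le G H') hw) p hg)

/-- When the call at the far end `v` of a dominant edge `(u, v)` ends, the rest of the cycle is
known. Otherwise, the lightest boundary edge on the side of `v` is not blocked, because a short
enough path cannot cross the dominant edge. So it is eligible for an active call; but that call
is at a vertex on the side of `u`, which is too far away to have blocked the edge. -/
theorem Consistent.reachable_of_isDominant [Finite V] (hw : ∀ e ∈ G.edgeSet, 0 ≤ w e) {s : V}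
    {H K : List V} {u v y : V} {T : G.Walk s v} (hA : Consistent G w δ ⟨H, v, y :: K, T⟩)
    (hnot : ∀ a b, ¬ Eligible G w δ H v a b) (hg : IsDominant G w s(u, v)) (hδ : δ < 0)
    (hu : ∀ z ∈ y :: K, ((knownGraph G H).deleteEdges {s(u, v)}).Reachable u z) :
    ((knownGraph G H).deleteEdges {s(u, v)}).Reachable v u := by
  by_contra hnr
  have hvH : v ∈ H := hA.active v (by simp)
  -- The tree path from `v` to `u` leaves the known part of the side of `v` along a boundary edge.
  obtain ⟨a, b, hab, hne, hva⟩ : ∃ a b, IsBoundary G H a b ∧ s(a, b) ≠ s(u, v) ∧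
      ((knownGraph G H).deleteEdges {s(u, v)}).Reachable v a := by
    obtain ⟨P⟩ := hg.2.1.connected.preconnected v u
    obtain ⟨d, -, h1, h2⟩ := P.exists_boundary_dart
      {x | x ∈ H ∧ ((knownGraph G H).deleteEdges {s(u, v)}).Reachable v x}
      ⟨hvH, .refl _⟩ (fun h => hnr h.2)
    have hd := SimpleGraph.deleteEdges_adj.1 d.adj
    have hne : s(d.fst, d.snd) ≠ s(u, v) := by simpa using hd.2
    have hK : ((knownGraph G H).deleteEdges {s(u, v)}).Adj d.fst d.snd :=
      SimpleGraph.deleteEdges_adj.2 ⟨⟨hd.1, Or.inl h1.1⟩, by simpa using hne⟩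
    exact ⟨d.fst, d.snd, ⟨hd.1, h1.1, fun h => h2 ⟨h, h1.2.trans hK.reachable⟩⟩, hne, h1.2⟩
  obtain ⟨a, b, hab, ⟨hne, hva⟩, hmin⟩ := exists_lightest_isBoundary w
    (P := fun a b => s(a, b) ≠ s(u, v) ∧
      ((knownGraph G H).deleteEdges {s(u, v)}).Reachable v a) ⟨a, b, hab, hne, hva⟩
  have hlt : w s(a, b) < w s(u, v) :=
    (weight_le_totalWeight_sub hw hg.1 hab.1 hne).trans_lt hg.2.2
  have hδlt : (1 + δ) * w s(a, b) < w s(u, v) := by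
    have := hw s(a, b) hab.1
    nlinarith
  obtain ⟨z, hz, he⟩ := hA.exists_eligible hw hab <| by
    rintro ⟨u', v', -, h, hlt', p, -, hp⟩
    have hav := reachable_deleteEdges_of_walkLength_lt hw (List.Subset.refl H) p
      (hp.trans_lt hδlt)
    have hne' : s(u', v') ≠ s(u, v) := fun h => (hlt'.trans hlt).ne (congrArg w h)
    have hK : ((knownGraph G H).deleteEdges {s(u, v)}).Adj u' v' :=
      SimpleGraph.deleteEdges_adj.2 ⟨⟨h.1, Or.inl h.2.1⟩, by simpa using hne'⟩
    exact (hmin u' v' h ⟨hne', (hva.trans hav).trans hK.reachable.symm⟩).not_gt hlt'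
  rcases List.mem_cons.1 hz with rfl | hz
  · exact hnot a b he
  refine hnr (SimpleGraph.Reachable.trans ?_ (hu z hz).symm)
  rcases he.2.2 with rfl | ⟨H', u', hH', -, -, -, p, -, hp⟩
  · exact hva
  · exact hva.trans
      (reachable_deleteEdges_of_walkLength_lt hw hH'.subset p (hp.trans_lt hδlt))

/-! ### The cost of the calls -/

open Classical in
/-- The bound on the cost of exploring the edge `e`, including the way back: `(4 + 2δ) |e|`, unless
`e` is dominant. A dominant edge is charged to the other edges of the graph. -/
noncomputable def edgeBudget [Finite V] (G : SimpleGraph V) (w : Sym2 V → ℝ) (δ : ℝ)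
    (e : Sym2 V) : ℝ :=
  if IsDominant G w e then (2 + δ) / (1 + δ) * (totalWeight G w - w e) else (4 + 2 * δ) * w e

/-- A reason why the way back from the call at `v` to its caller `y` will have length at most `ρ`,
where `K` are the callers of `y`: either there is a known walk of that length, or `v` is the far end
of a dominant edge, the remaining graph has a path of that length, and all callers are on the near
side of the edge. In the latter case the path is known by the time it is needed, according to
`Consistent.reachable_of_isDominant`. -/
def ReturnBound [Finite V] (G : SimpleGraph V) (w : Sym2 V → ℝ) (δ : ℝ) (H : List V) (v y : V)
    (K : List V) (ρ : ℝ) : Prop :=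
  (∃ p : (knownGraph G H).Walk v y, walkLength w p ≤ ρ) ∨
    ∃ u, IsDominant G w s(u, v) ∧ δ < 0 ∧
      (∀ z ∈ y :: K, ((knownGraph G H).deleteEdges {s(u, v)}).Reachable u z) ∧
      ∃ q : (G.deleteEdges {s(u, v)}).Walk v y, q.IsPath ∧ walkLength w q ≤ ρ

theorem ReturnBound.mono [Finite V] {H H' : List V} (hH : H ⊆ H') {v y : V} {K : List V} {ρ : ℝ}
    (h : ReturnBound G w δ H v y K ρ) : ReturnBound G w δ H' v y K ρ := by
  refine h.imp (fun ⟨p, hp⟩ => ⟨p.mapLe (knownGraph_mono hH), ?_⟩)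
    fun ⟨u, hu, hδ, hz, hq⟩ => ⟨u, hu, hδ, fun z h => (hz z h).mono ?_, hq⟩
  · rwa [walkLength_mapLe]
  · exact SimpleGraph.deleteEdges_mono (knownGraph_mono hH)

/-- Every promised bound for a way back is kept. -/
theorem Consistent.backtrack_cost [Finite V] (hw : ∀ e ∈ G.edgeSet, 0 ≤ w e) {s : V}
    {H K : List V} {v y : V} {T : G.Walk s v} (hA : Consistent G w δ ⟨H, v, y :: K, T⟩)
    (hnot : ∀ a b, ¬ Eligible G w δ H v a b) {p : (knownGraph G H).Walk v y}
    (hp : IsShortestPath w p) {ρ : ℝ} (hρ : ReturnBound G w δ H v y K ρ) :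
    walkLength w p ≤ ρ := by
  classical
  rcases hρ with ⟨q, hq⟩ | ⟨u, hg, hδ, hu, q, hq, hqρ⟩
  · exact (hp.2 q).trans hq
  · obtain ⟨q'⟩ := (hA.reachable_of_isDominant hw hnot hg hδ hu).trans (hu y (by simp))
    have hle : (knownGraph G H).deleteEdges {s(u, v)} ≤ G.deleteEdges {s(u, v)} :=
      SimpleGraph.deleteEdges_mono (knownGraph_le G H)
    have heq := eq_of_isAcyclic_of_isPath hg.2.1.isAcyclic hq
      ((SimpleGraph.Walk.isPath_mapLe hle).2 q'.bypass_isPath)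
    refine le_trans ?_ hqρ
    rw [heq, walkLength_mapLe]
    simpa using hp.2 (q'.bypass.mapLe ((knownGraph G H).deleteEdges_le _))

/-- The searcher reaches the near end of the edge to be explored within `(1 + δ)` times the weight
of this edge. -/
theorem Eligible.walkLength_le (hw : ∀ e ∈ G.edgeSet, 0 ≤ w e) (hδ : -1 < δ) {H : List V}
    {y u v : V} (he : Eligible G w δ H y u v) {p : (knownGraph G H).Walk y u}
    (hp : IsShortestPath w p) : walkLength w p ≤ (1 + δ) * w s(u, v) := by
  rcases he.2.2 with rfl | ⟨H', u', hH', -, -, -, q, -, hq⟩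
  · refine (hp.2 .nil).trans ?_
    rw [walkLength_nil]
    exact mul_nonneg (by linarith) (hw _ he.1.1)
  · refine (hp.2 (q.mapLe (knownGraph_mono hH'.subset)).reverse).trans ?_
    rwa [walkLength_reverse, walkLength_mapLe]

/-- When a dominant edge `(u, v)` is explored, the boundary edge on the remaining path from `u` to
`v` is lighter and does not block it, so this path is longer than `(1 + δ) |(u, v)|`. -/
theorem lt_walkLength_of_isDominant [Finite V] (hw : ∀ e ∈ G.edgeSet, 0 ≤ w e) {H : List V}
    {y u v : V} (he : Eligible G w δ H y u v) (hg : IsDominant G w s(u, v))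
    (P : (G.deleteEdges {s(u, v)}).Walk u v) : (1 + δ) * w s(u, v) < walkLength w P := by
  have hle := G.deleteEdges_le {s(u, v)}
  have hw' := nonneg_of_le (knownGraph_le G H) hw
  obtain ⟨x, z, hxz, hmem, q, hq⟩ := exists_isBoundary_of_walk hle P he.1.2.1 he.1.2.2
  obtain ⟨q', hq'⟩ := exists_isShortestPath hw' q.reachable
  have hne : s(x, z) ≠ s(u, v) := by
    have := P.edges_subset_edgeSet hmem
    simp only [SimpleGraph.edgeSet_deleteEdges] at this
    exact this.2
  have hlt : w s(x, z) < w s(u, v) :=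
    (weight_le_totalWeight_sub hw hg.1 hxz.1 hne).trans_lt hg.2.2
  have h : (1 + δ) * w s(u, v) < walkLength w q' := by
    by_contra! h
    exact he.2.1 ⟨x, z, he.1, hxz, hlt, q', hq', h⟩
  exact h.trans_le ((hq'.2 q).trans (sum_map_le_of_sublist hq
    fun e h => hw e (SimpleGraph.edgeSet_mono hle (P.edges_subset_edgeSet h))))

/-- The budget of an edge pays for exploring it and for the way back. For a dominant edge the way
back is promised along the path of the tree that remains without this edge. -/
theorem Consistent.explore_cost [Finite V] (hw : ∀ e ∈ G.edgeSet, 0 ≤ w e) (hδ : -1 < δ) {s : V}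
    {H K : List V} {y u v : V} {T : G.Walk s y} (hA : Consistent G w δ ⟨H, y, K, T⟩)
    (he : Eligible G w δ H y u v) {p : (knownGraph G H).Walk y u} (hp : IsShortestPath w p) :
    ∃ ρ, ReturnBound G w δ (v :: H) v y K ρ ∧
      walkLength w p + w s(u, v) + ρ ≤ edgeBudget G w δ s(u, v) := by
  classical
  have hpl := he.walkLength_le hw hδ hp
  by_cases hg : IsDominant G w s(u, v)
  · have hle := G.deleteEdges_le {s(u, v)}
    have hw' := nonneg_of_le hle hw
    have hconn := hg.2.1.connected.preconnected
    obtain ⟨P, hP⟩ := (hconn u v).exists_isPath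
    obtain ⟨q, hq⟩ := (hconn v y).exists_isPath
    have hr := lt_walkLength_of_isDominant hw he hg P
    have hrR := walkLength_le_totalWeight hw' hP
    rw [totalWeight_deleteEdges hg.1] at hrR
    have hgR := hg.2.2
    -- Here `(1 + δ) |g| < r ≤ R < |g|`.
    have hδ0 : δ < 0 := by
      by_contra! h
      nlinarith [hw _ hg.1]
    have hpg : s(u, v) ∉ p.edges := fun h => by
      have := le_walkLength_of_mem_edges (nonneg_of_le (knownGraph_le G H) hw) p h
      linarith
    have hp' : ∀ e ∈ p.edges, e ∈ (G.deleteEdges {s(u, v)}).edgeSet := fun e h => by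
      rw [SimpleGraph.edgeSet_deleteEdges]
      refine ⟨SimpleGraph.edgeSet_mono (knownGraph_le G H) (p.edges_subset_edgeSet h), ?_⟩
      rintro rfl
      exact hpg h
    have htri := walkLength_triangle_le hg.2.1 hw' (hp.1.transfer hp') hP hq
    rw [totalWeight_deleteEdges hg.1,
      walkLength_congr w (q := p) (SimpleGraph.Walk.edges_transfer _ _)] at htri
    refine ⟨walkLength w q, Or.inr ⟨u, hg, hδ0, fun z hz => ?_, q, hq, le_rfl⟩, ?_⟩
    · obtain ⟨p₁, h₁⟩ := hA.joined u he.1.2.1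
      obtain ⟨p₂, h₂⟩ := hA.joined z (hA.active z hz)
      have key := fun (x : V) (p : G.Walk s x) (h : ∀ y ∈ p.support, y ∈ H) =>
        reachable_of_support_subset p h (List.subset_cons_self v H) he.1.2.2
          (Sym2.mem_mk_right u v)
      exact (key u p₁ h₁).symm.trans (key z p₂ h₂)
    · rw [edgeBudget, if_pos hg, div_mul_eq_mul_div, le_div_iff₀ (by linarith)]
      nlinarith [mul_nonneg (neg_nonneg.2 hδ0.le) (sub_nonneg.2 hrR)]
  · have hK : (knownGraph G H).Adj u v := ⟨he.1.1, Or.inl he.1.2.1⟩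
    refine ⟨walkLength w p + w s(u, v), Or.inl
      ⟨((p.concat hK).mapLe (knownGraph_mono (List.subset_cons_self v H))).reverse, ?_⟩, ?_⟩
    · rw [walkLength_reverse, walkLength_mapLe, walkLength_concat]
    · rw [edgeBudget, if_neg hg]
      linarith

/-- The sum of bounds for the ways back of all active calls. The list consists of the suspended
calls. -/
inductive PendingReturns [Finite V] (G : SimpleGraph V) (w : Sym2 V → ℝ) (δ : ℝ) (H : List V) :
    V → List V → ℝ → Prop
  | nil (v : V) : PendingReturns G w δ H v [] 0
  | cons {v y : V} {K : List V} {ρ σ : ℝ} (h : ReturnBound G w δ H v y K ρ)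
      (h' : PendingReturns G w δ H y K σ) : PendingReturns G w δ H v (y :: K) (ρ + σ)

theorem PendingReturns.mono [Finite V] {H H' : List V} (hH : H ⊆ H') {v : V} {K : List V} {σ : ℝ}
    (h : PendingReturns G w δ H v K σ) : PendingReturns G w δ H' v K σ := by
  induction h with
  | nil v => exact .nil v
  | cons h _ ih => exact .cons (h.mono hH) ih

/-- The route so far and the ways back still to be made are paid for by the budgets of the
edges in some set of edges between explored vertices. -/
def WithinBudget [Finite V] (G : SimpleGraph V) (w : Sym2 V → ℝ) (δ : ℝ) {s : V}
    (A : Config G s) : Prop :=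
  ∃ (E : Finset (Sym2 V)) (σ : ℝ), (∀ e ∈ E, e ∈ G.edgeSet ∧ ∀ x ∈ e, x ∈ A.explored) ∧
    PendingReturns G w δ A.explored A.current A.callers σ ∧
    walkLength w A.tour + σ ≤ ∑ e ∈ E, edgeBudget G w δ e

theorem WithinBudget.init [Finite V] (s : V) : WithinBudget G w δ (Config.init G s) :=
  ⟨∅, 0, by simp, .nil s, by simp [Config.init]⟩

theorem WithinBudget.step [Finite V] (hw : ∀ e ∈ G.edgeSet, 0 ≤ w e) (hδ : -1 < δ) {s : V}
    {A B : Config G s} (hA : Consistent G w δ A) (hbud : WithinBudget G w δ A)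
    (h : Step G w δ s A B) : WithinBudget G w δ B := by
  classical
  obtain ⟨E, σ, hE, hσ, hle⟩ := hbud
  cases h with
  | @explore H K y u v T he p hp =>
    obtain ⟨ρ, hρ, hcost⟩ := hA.explore_cost hw hδ he hp
    -- The new edge is not in `E`, since `v` was unexplored.
    have hnew : s(u, v) ∉ E := fun h => he.1.2.2 ((hE _ h).2 v (Sym2.mem_mk_right u v))
    refine ⟨insert s(u, v) E, ρ + σ, fun e h => ?_,
      .cons hρ (hσ.mono (List.subset_cons_self v H)), ?_⟩
    · rcases Finset.mem_insert.1 h with rfl | h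
      · refine ⟨he.1.1, fun x hx => ?_⟩
        rcases Sym2.mem_iff.1 hx with rfl | rfl
        · exact List.mem_cons_of_mem _ he.1.2.1
        · exact List.mem_cons_self
      · exact ⟨(hE e h).1, fun x hx => List.mem_cons_of_mem _ ((hE e h).2 x hx)⟩
    · rw [Finset.sum_insert hnew, walkLength_concat, walkLength_append, walkLength_mapLe]
      dsimp only at hle
      linarith
  | @backtrack H K v y T he p hp =>
    cases hσ with
    | @cons _ _ _ ρ σ hρ hσ =>
      refine ⟨E, σ, hE, hσ, ?_⟩
      have := hA.backtrack_cost hw he hp hρ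
      rw [walkLength_append, walkLength_mapLe]
      dsimp only at hle
      linarith

theorem consistent_and_withinBudget [Finite V] (hw : ∀ e ∈ G.edgeSet, 0 ≤ w e) (hδ : -1 < δ)
    {s : V} {A : Config G s} (h : Relation.ReflTransGen (Step G w δ s) (Config.init G s) A) :
    Consistent G w δ A ∧ WithinBudget G w δ A := by
  induction h with
  | refl => exact ⟨Consistent.init s, WithinBudget.init s⟩
  | tail _ hstep ih => exact ⟨ih.1.step hstep, ih.2.step hw hδ ih.1 hstep⟩

/-! ### The competitive ratio -/

theorem edgeBudget_nonneg [Finite V] (hw : ∀ e ∈ G.edgeSet, 0 ≤ w e) (hδ : -1 < δ) {e : Sym2 V}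
    (he : e ∈ G.edgeSet) : 0 ≤ edgeBudget G w δ e := by
  rw [edgeBudget]
  split_ifs
  · refine mul_nonneg (div_nonneg (by linarith) (by linarith)) ?_
    rw [← totalWeight_deleteEdges he]
    exact Finset.sum_nonneg fun f hf =>
      nonneg_of_le (G.deleteEdges_le {e}) hw f (mem_edges.1 hf)
  · exact mul_nonneg (by linarith) (hw e he)

theorem sum_edgeBudget_le [Finite V] (hG : IsUnicyclic G) (hw : ∀ e ∈ G.edgeSet, 0 ≤ w e)
    (hδ : -1 < δ) {s : V} {T : G.Walk s s} (hT : IsTour T) :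
    ∑ e ∈ edges G, edgeBudget G w δ e ≤
      max (4 + 2 * δ) (3 + (δ ^ 2 + δ / 2) / (1 + δ)) * walkLength w T := by
  classical
  have hT0 := walkLength_nonneg hw T
  by_cases hdom : ∃ g, IsDominant G w g
  · obtain ⟨g, hg⟩ := hdom
    have hother : ∀ e ∈ (edges G).erase g, edgeBudget G w δ e = (4 + 2 * δ) * w e := by
      intro e he
      obtain ⟨hne, he⟩ := Finset.mem_erase.1 he
      -- Two edges cannot both outweigh the rest of the graph.
      refine if_neg fun hd => ?_
      have h1 := weight_le_totalWeight_sub hw hg.1 (mem_edges.1 he) hne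
      have h2 := weight_le_totalWeight_sub hw (mem_edges.1 he) hg.1 hne.symm
      linarith [hg.2.2, hd.2.2]
    have hsum : ∑ e ∈ (edges G).erase g, w e = totalWeight G w - w g :=
      Finset.sum_erase_eq_sub (mem_edges.2 hg.1)
    have hlow : 2 * (totalWeight G w - w g) ≤ walkLength w T := by
      have hgR := hg.2.2
      rcases totalWeight_le_or_of_isTour hG hw hT with h | ⟨g', hg', -, h⟩
      · linarith
      · by_cases hne : g = g'
        · rwa [hne]
        · linarith [weight_le_totalWeight_sub hw hg' hg.1 hne]
    rw [← Finset.add_sum_erase _ _ (mem_edges.2 hg.1), Finset.sum_congr rfl hother,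
      ← Finset.mul_sum, hsum, edgeBudget, if_pos hg]
    have h1 : (0 : ℝ) < 1 + δ := by linarith
    have hc : (2 + δ) / (1 + δ) * (totalWeight G w - w g) +
        (4 + 2 * δ) * (totalWeight G w - w g) =
          (3 + (δ ^ 2 + δ / 2) / (1 + δ)) * (2 * (totalWeight G w - w g)) := by
      field_simp
      ring
    rw [hc]
    have hc0 : 0 ≤ 3 + (δ ^ 2 + δ / 2) / (1 + δ) := by
      have : 3 + (δ ^ 2 + δ / 2) / (1 + δ) = (2 + δ) * (3 + 2 * δ) / (2 * (1 + δ)) := by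
        field_simp
        ring
      rw [this]
      exact div_nonneg (mul_nonneg (by linarith) (by linarith)) (by linarith)
    exact (mul_le_mul_of_nonneg_left hlow hc0).trans
      (mul_le_mul_of_nonneg_right (le_max_right _ _) hT0)
  · have hall : ∀ e ∈ edges G, edgeBudget G w δ e = (4 + 2 * δ) * w e := fun e _ =>
      if_neg fun hd => hdom ⟨e, hd⟩
    have hlow : totalWeight G w ≤ walkLength w T := by
      rcases totalWeight_le_or_of_isTour hG hw hT with h | ⟨g, hg, htree, h⟩
      · exact h
      · have : w g ≤ totalWeight G w - w g := by
          by_contra! h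
          exact hdom ⟨g, hg, htree, h⟩
        linarith
    rw [Finset.sum_congr rfl hall, ← Finset.mul_sum]
    exact (mul_le_mul_of_nonneg_left hlow (by linarith)).trans
      (mul_le_mul_of_nonneg_right (le_max_left _ _) hT0)

theorem blockingCompetitive_max [Finite V] (hG : IsUnicyclic G)
    (hw : ∀ e ∈ G.edgeSet, 0 ≤ w e) (s : V) (hδ : -1 < δ) :
    BlockingCompetitive G w s δ (max (4 + 2 * δ) (3 + (δ ^ 2 + δ / 2) / (1 + δ))) := by
  refine ⟨not_exists_infinite_run s, fun A hA hterm => ?_⟩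
  obtain ⟨hcons, E, σ, hE, hσ, hle⟩ := consistent_and_withinBudget hw hδ hA
  obtain ⟨hK, htour⟩ := hcons.isTour hG.1 hw hterm
  refine ⟨htour, fun T hT => ?_⟩
  rw [hK] at hσ
  cases hσ
  rw [add_zero] at hle
  exact (hle.trans (Finset.sum_le_sum_of_subset_of_nonneg
    (fun e he => mem_edges.2 (hE e he).1)
    fun e he _ => edgeBudget_nonneg hw hδ (mem_edges.1 he))).trans (sum_edgeBudget_le hG hw hδ hT)

end GraphExploration

theorem mainTheorem2 {V : Type*} [Finite V] (G : SimpleGraph V)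
    (hG : GraphExploration.IsUnicyclic G)
    (w : Sym2 V → ℝ) (hw : ∀ e ∈ G.edgeSet, 0 < w e) (s : V) :
    (∀ δ : ℝ, 0 < δ → GraphExploration.BlockingCompetitive G w s δ (4 + 2 * δ)) ∧
    (∀ δ : ℝ, -1 < δ → δ ≤ 0 →
      GraphExploration.BlockingCompetitive G w s δ
        (max (4 + 2 * δ) (3 + (δ ^ 2 + δ / 2) / (1 + δ)))) ∧
    GraphExploration.BlockingCompetitive G w s (-1 / 2) 3 := by
  have key := fun δ : ℝ => GraphExploration.blockingCompetitive_max (δ := δ) hG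
    (fun e he => (hw e he).le) s
  refine ⟨fun δ hδ => ?_, fun δ hδ _ => key δ hδ, ?_⟩
  · -- For `0 < δ` the first term of the maximum is the larger one.
    have h := key δ (by linarith)
    rwa [max_eq_left] at h
    have : (δ ^ 2 + δ / 2) / (1 + δ) ≤ 1 + 2 * δ := by
      rw [div_le_iff₀ (by linarith)]
      nlinarith
    linarith
  · have h := key (-1 / 2) (by norm_num)
    rwa [show max (4 + 2 * (-1 / 2 : ℝ)) (3 + ((-1 / 2) ^ 2 + (-1 / 2) / 2) / (1 + -1 / 2)) = 3 by
      norm_num] at h
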